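/- Let $\lambda=(\lambda_n)_{n\in\mathbb N}$ be a frequency, i.e. a strictly increasing sequence of non-negative real numbers (the usual extra condition $\lambda_n\to\infty$ may be imposed but is not needed), and let $1\le p\le\infty$. A pair $(G,\beta)$ of a compact (Hausdorff) abelian group $G$ and a continuous homomorphism $\beta\colon\mathbb R\to G$ with dense range is called a $\lambda$-Dirichlet group if for every $n$ there is a continuous character $h_{\lambda_n}=h_{\lambda_n}^{(G,\beta)}\in\widehat G$ (necessarily unique) with $h_{\lambda_n}(\beta(t))=e^{-i\lambda_n t}$ for all $t\in\mathbb R$. For such a group, $L_p(G)$ is taken with respect to the normalized Haar measure $m$, $\widehat f(\gamma)=\int_G f\,\overline{\gamma}\,dm$ for $\gamma\in\widehat G$, and $$H_p^\lambda(G)=\{f\in L_p(G):\ \widehat f(\gamma)\neq 0 \text{ only if } \gamma=h_{\lambda_n}\text{ for some } n\}$$ with the norm of $L_p(G)$. Let $\overline{\mathbb R}$ be the Bohr compactification of $\mathbb R$, i.e. the dual group of $\mathbb R$ with the discrete topology, together with $\beta_{\overline{\mathbb R}}\colon\mathbb R\to\overline{\mathbb R}$, $x\mapsto[t\mapsto e^{-ixt}]$.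 Then $(\overline{\mathbb R},\beta_{\overline{\mathbb R}})$ is a $\lambda$-Dirichlet group, and the following hold. 1. For every $\lambda$-Dirichlet group $(G,\beta)$ there is a linear isometry $\Psi$ from $H_p^\lambda(G)$ onto $H_p^\lambda(\overline{\mathbb R})$ such that $\widehat f\big(h_{\lambda_n}^{(G,\beta)}\big)=\widehat{\Psi f}\big(h_{\lambda_n}^{(\overline{\mathbb R},\beta_{\overline{\mathbb R}})}\big)$ for all $f\in H_p^\lambda(G)$ and all $n\in\mathbb N$. 2. For any two $\lambda$-Dirichlet groups $(G,\beta_G)$ and $(H,\beta_H)$ there is a linear isometry $\Psi$ from $H_p^\lambda(G)$ onto $H_p^\lambda(H)$ such that $\widehat f\big(h_{\lambda_n}^{(G,\beta_G)}\big)=\widehat{\Psi f}\big(h_{\lambda_n}^{(H,\beta_H)}\big)$ for all $f\in H_p^\lambda(G)$ and all $n\in\mathbb N$. 3. For a $\lambda$-Dirichlet group $(G,\beta)$ let $\mathcal H_p(\lambda)$ be the space of all formal Dirichlet series $D=\sum a_n e^{-\lambda_n s}$ for which there is $f\in H_p^\lambda(G)$ with $a_n=\widehat f(h_{\lambda_n})$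 for all $n$, normed by $\|D\|_p=\|f\|_p$. The function $f$ is uniquely determined by $D$, so that this norm is well defined, and neither the space $\mathcal H_p(\lambda)$ nor its norm depends on the choice of the $\lambda$-Dirichlet group $(G,\beta)$. -/

import Mathlib

open MeasureTheory
open scoped ENNReal

set_option linter.unusedSectionVars false

noncomputable section

/-- A frequency: a non-negative, strictly increasing sequence of real numbers. The usual additional
requirement that the sequence tends to infinity is not imposed, so that such sequences are covered
as a special case. -/
structure IsFrequency (lam : ℕ → ℝ) : Prop where
  nonneg : ∀ n, 0 ≤ lam n
  strictMono : StrictMono lam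

/-! ### Dirichlet groups

The additive group `ℝ` with its usual topology is written multiplicatively, as `Multiplicative ℝ`.
A compact abelian group `G` is a compact Hausdorff commutative topological group, and its dual group
is `PontryaginDual G`. -/

/-- The character `t ↦ e^{-ixt}` of the real line. -/
def realChar (x : ℝ) : PontryaginDual (Multiplicative ℝ) :=
  ({ toFun := fun t => Circle.exp (-(x * t.toAdd))
     map_one' := by simp
     map_mul' := fun s t => by
      rw [← Circle.exp_add]
      congr 1
      rw [toAdd_mul]
      ring
     continuous_toFun := by
      refine Circle.exp.continuous.comp ?_
      exact (continuous_const.mul continuous_toAdd).neg } : Multiplicative ℝ →ₜ* Circle)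

section DirichletGroup

variable {G : Type*} [CommGroup G] [TopologicalSpace G] [IsTopologicalGroup G]

/-- For a compact abelian group `G` and a continuous homomorphism `β : ℝ → G`, the pair `(G, β)` is
a Dirichlet group if `β` has dense range. -/
def IsDirichletGroup [CompactSpace G] [T2Space G] (β : Multiplicative ℝ →ₜ* G) : Prop :=
  DenseRange β

/-- `(G, β)` is a `λ`-Dirichlet group: it is a Dirichlet group and each character `e^{-iλₙ·}` lies
in the range of the dual map `γ ↦ γ ∘ β` of `β`. -/
structure IsLambdaDirichletGroup [CompactSpace G] [T2Space G]
    (lam : ℕ → ℝ) (β : Multiplicative ℝ →ₜ* G) : Prop where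
  isDirichletGroup : IsDirichletGroup β
  mem_range : ∀ n, realChar (lam n) ∈ Set.range (PontryaginDual.map β)

open Classical in
/-- The character `h_x` of `G` that extends `e^{-ix·}`, that is, `h_x ∘ β = e^{-ix·}`. It is unique
when it exists and `β` has dense range; the value is `1` if there is none. -/
def extChar (β : Multiplicative ℝ →ₜ* G) (x : ℝ) : PontryaginDual G :=
  if h : ∃ γ : PontryaginDual G, PontryaginDual.map β γ = realChar x then h.choose else 1

theorem IsDirichletGroup.map_injective [CompactSpace G] [T2Space G] {β : Multiplicative ℝ →ₜ* G}
    (hβ : IsDirichletGroup β) : Function.Injective (PontryaginDual.map β) := by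
  intro γ γ' h
  have h1 : (γ : G → Circle) = γ' := by
    refine DenseRange.equalizer hβ (map_continuous γ) (map_continuous γ') ?_
    funext t
    exact DFunLike.congr_fun h t
  exact DFunLike.coe_injective h1

theorem IsLambdaDirichletGroup.map_eq_iff [CompactSpace G] [T2Space G] {lam : ℕ → ℝ}
    {β : Multiplicative ℝ →ₜ* G} (hβ : IsLambdaDirichletGroup lam β) (n : ℕ)
    (γ : PontryaginDual G) :
    PontryaginDual.map β γ = realChar (lam n) ↔ γ = extChar β (lam n) := by
  have h : ∃ γ : PontryaginDual G, PontryaginDual.map β γ = realChar (lam n) := hβ.mem_range n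
  have hs : PontryaginDual.map β (extChar β (lam n)) = realChar (lam n) := by
    unfold extChar
    rw [dif_pos h]
    exact h.choose_spec
  constructor
  · intro hγ
    exact hβ.isDirichletGroup.map_injective (hγ.trans hs.symm)
  · rintro rfl
    exact hs

end DirichletGroup

/-! ### The Bohr compactification of the real line -/

/-- The additive group of the real numbers, written multiplicatively, with the discrete topology. -/
def RealDiscrete : Type := Multiplicative ℝ

instance : CommGroup RealDiscrete := inferInstanceAs (CommGroup (Multiplicative ℝ))
instance : TopologicalSpace RealDiscrete := ⊥
instance : DiscreteTopology RealDiscrete := ⟨rfl⟩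

/-- The real number that underlies an element of `RealDiscrete`. -/
def RealDiscrete.toReal (t : RealDiscrete) : ℝ := Multiplicative.toAdd (α := ℝ) t

/-- The Bohr compactification of `ℝ`: the dual group of `ℝ` with the discrete topology. -/
abbrev BohrCompactification : Type := PontryaginDual RealDiscrete

instance : MeasurableSpace BohrCompactification := borel _
instance : BorelSpace BohrCompactification := ⟨rfl⟩

/-- The character `t ↦ e^{-ixt}` of the discrete group of real numbers. -/
def discreteChar (x : ℝ) : BohrCompactification :=
  ({ toFun := fun t => Circle.exp (-(x * t.toReal))
     map_one' := by
      have h : RealDiscrete.toReal 1 = 0 := rfl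
      simp [h]
     map_mul' := fun s t => by
      have h : RealDiscrete.toReal (s * t) = s.toReal + t.toReal := rfl
      rw [← Circle.exp_add, h]
      congr 1
      ring
     continuous_toFun := continuous_of_discreteTopology } : RealDiscrete →ₜ* Circle)

/-- The canonical homomorphism `x ↦ [t ↦ e^{-ixt}]` from `ℝ` to its Bohr compactification. -/
def bohrEmbedding : Multiplicative ℝ →ₜ* BohrCompactification where
  toFun x := discreteChar x.toAdd
  map_one' := by
    refine PontryaginDual.ext fun t => ?_
    change Circle.exp (-((0 : ℝ) * t.toReal)) = 1
    simp
  map_mul' x y := by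
    refine PontryaginDual.ext fun t => ?_
    change Circle.exp (-((x.toAdd + y.toAdd) * t.toReal)) =
      Circle.exp (-(x.toAdd * t.toReal)) * Circle.exp (-(y.toAdd * t.toReal))
    rw [← Circle.exp_add]
    congr 1
    ring
  continuous_toFun := by
    refine ContinuousMonoidHom.continuous_of_continuous_uncurry
      (fun x : Multiplicative ℝ => (discreteChar x.toAdd : RealDiscrete →ₜ* Circle)) ?_
    change Continuous fun q : Multiplicative ℝ × RealDiscrete =>
      Circle.exp (-(q.1.toAdd * q.2.toReal))
    have h : Continuous RealDiscrete.toReal := continuous_of_discreteTopology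
    exact Circle.exp.continuous.comp
      ((continuous_toAdd.comp continuous_fst).mul (h.comp continuous_snd)).neg

/-! ### Hardy spaces on compact abelian groups -/

section Hardy

variable (G : Type*) [CommGroup G] [TopologicalSpace G] [IsTopologicalGroup G] [CompactSpace G]
  [MeasurableSpace G] [BorelSpace G]

/-- The normalized Haar measure of a compact group. -/
abbrev compactHaar : Measure G := Measure.haarMeasure ⊤

instance : IsProbabilityMeasure (compactHaar G) :=
  ⟨by
    have h := Measure.haarMeasure_self (K₀ := (⊤ : TopologicalSpace.PositiveCompacts G))
    simpa using h⟩

variable {G}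

/-- The Fourier coefficient `f̂(γ) = ∫ f(x) conj(γ(x)) dx`. -/
def haarFourierCoeff (f : G → ℂ) (γ : PontryaginDual G) : ℂ :=
  ∫ x, f x * (starRingEnd ℂ) (γ x : ℂ) ∂(compactHaar G)

theorem integrable_mul_char {p : ℝ≥0∞} (hp : 1 ≤ p) (f : Lp ℂ p (compactHaar G))
    (γ : PontryaginDual G) :
    Integrable (fun x => f x * (starRingEnd ℂ) (γ x : ℂ)) (compactHaar G) := by
  have hf : Integrable f (compactHaar G) := (Lp.memLp f).integrable hp
  have hc : Continuous fun x => (starRingEnd ℂ) (γ x : ℂ) :=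
    Complex.continuous_conj.comp (continuous_subtype_val.comp (map_continuous γ))
  refine hf.mul_bdd (c := 1) ?_ ?_
  · exact hc.measurable.aestronglyMeasurable
  · exact Filter.Eventually.of_forall fun x => by simp [Circle.norm_coe]

theorem haarFourierCoeff_add {p : ℝ≥0∞} (hp : 1 ≤ p) (f g : Lp ℂ p (compactHaar G))
    (γ : PontryaginDual G) :
    haarFourierCoeff (f + g : Lp ℂ p (compactHaar G)) γ =
      haarFourierCoeff f γ + haarFourierCoeff g γ := by
  unfold haarFourierCoeff
  rw [← integral_add (integrable_mul_char hp f γ) (integrable_mul_char hp g γ)]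
  refine integral_congr_ae ?_
  filter_upwards [Lp.coeFn_add f g] with x hx
  rw [hx, Pi.add_apply, add_mul]

theorem haarFourierCoeff_smul {p : ℝ≥0∞} (c : ℂ) (f : Lp ℂ p (compactHaar G))
    (γ : PontryaginDual G) :
    haarFourierCoeff (c • f : Lp ℂ p (compactHaar G)) γ = c * haarFourierCoeff f γ := by
  unfold haarFourierCoeff
  rw [← integral_const_mul]
  refine integral_congr_ae ?_
  filter_upwards [Lp.coeFn_smul c f] with x hx
  rw [hx, Pi.smul_apply, smul_eq_mul, mul_assoc]

/-- The Hardy space `H_p^E(G)`: all `f ∈ L_p(G)` whose Fourier transform is supported in `E`. It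
carries the norm of `L_p(G)`. -/
def hardySpace (p : ℝ≥0∞) [hp : Fact (1 ≤ p)] (E : Set (PontryaginDual G)) :
    Submodule ℂ (Lp ℂ p (compactHaar G)) where
  carrier := {f | ∀ γ : PontryaginDual G, haarFourierCoeff f γ ≠ 0 → γ ∈ E}
  zero_mem' := by
    intro γ h
    refine absurd ?_ h
    simpa using haarFourierCoeff_smul (0 : ℂ) (0 : Lp ℂ p (compactHaar G)) γ
  add_mem' := by
    intro f g hf hg γ h
    by_contra hγ
    refine h ?_
    rw [haarFourierCoeff_add hp.out, not_not.1 (mt (hf γ) hγ), not_not.1 (mt (hg γ) hγ), add_zero]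
  smul_mem' := by
    intro c f hf γ h
    refine hf γ fun h0 => h ?_
    rw [haarFourierCoeff_smul, h0, mul_zero]

/-- The Hardy space `H_p^λ(G)`, that is, `H_p^E(G)` with `E = {h_{λₙ} : n ∈ ℕ}`. -/
def lambdaHardySpace (p : ℝ≥0∞) [Fact (1 ≤ p)] (lam : ℕ → ℝ) (β : Multiplicative ℝ →ₜ* G) :
    Submodule ℂ (Lp ℂ p (compactHaar G)) :=
  hardySpace p (Set.range fun n => extChar β (lam n))

/-! ### Hardy spaces of general Dirichlet series -/

/-- Formal `λ`-Dirichlet series `∑ aₙ e^{-λₙ s}`, given by their sequences `(aₙ)` of coefficients. -/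
abbrev FormalDirichletSeries (_lam : ℕ → ℝ) : Type := ℕ → ℂ

/-- The Bohr map `H_p^λ(G) → 𝒟(λ)`, which sends `f` to `∑ f̂(h_{λₙ}) e^{-λₙ s}`. -/
def bohrMap (p : ℝ≥0∞) [hp : Fact (1 ≤ p)] (lam : ℕ → ℝ) (β : Multiplicative ℝ →ₜ* G) :
    lambdaHardySpace p lam β →ₗ[ℂ] FormalDirichletSeries lam where
  toFun f n := haarFourierCoeff (f : Lp ℂ p (compactHaar G)) (extChar β (lam n))
  map_add' f g := by
    funext n
    exact haarFourierCoeff_add hp.out (f : Lp ℂ p (compactHaar G)) g _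
  map_smul' c f := by
    funext n
    exact haarFourierCoeff_smul c (f : Lp ℂ p (compactHaar G)) _

/-- The space `ℋ_p(λ)`, formed with `(G, β)`: all `∑ aₙ e^{-λₙ s}` for which there is some
`f ∈ H_p^λ(G)` such that `aₙ = f̂(h_{λₙ})` for all `n`. -/
def dirichletHardySpace (p : ℝ≥0∞) [Fact (1 ≤ p)] (lam : ℕ → ℝ) (β : Multiplicative ℝ →ₜ* G) :
    Submodule ℂ (FormalDirichletSeries lam) :=
  LinearMap.range (bohrMap p lam β)

/-- The norm of `ℋ_p(λ)`, formed with `(G, β)`: the norm of the function `f ∈ H_p^λ(G)` whose image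
under the Bohr map is `D`. (The infimum is over a single number when the Bohr map is injective.) -/
def dirichletHardyNorm (p : ℝ≥0∞) [Fact (1 ≤ p)] (lam : ℕ → ℝ) (β : Multiplicative ℝ →ₜ* G)
    (D : FormalDirichletSeries lam) : ℝ :=
  sInf {r : ℝ | ∃ f : lambdaHardySpace p lam β, bohrMap p lam β f = D ∧ ‖f‖ = r}

end Hardy

end

/-! Given two `λ`-Dirichlet groups `(G, β)` and `(H, β')`, the closure `K` of `{(β t, β' t)}` in `G
× H` maps onto both factors, since the projections have compact and dense images
(`exists_common_cover`). It therefore suffices to compare `G` with a group `K` that has `G` as a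
quotient `q : K → G` (`exists_hardy_equiv_of_surjective`). The isometry is `f ↦ f ∘ q`: `q` carries
Haar measure to Haar measure, coefficients at `γ` and `γ ∘ q` agree, and all other coefficients of
`f ∘ q` vanish by invariance under `ker q`. It is onto because the conditional expectation of `F` on
the σ-algebra generated by `q` has the form `g ∘ q` and, when the spectrum of `F` comes from `G`,
the same Fourier coefficients as `F`. No approximation by polynomials occurs, so `p = ∞` needs no
separate treatment.

The analytic input is the uniqueness of Fourier coefficients in `L¹`
(`ae_eq_of_haarFourierCoeff_eq`), which also makes the Bohr map injective. It comes from Gelfand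
theory: `f ≠ 0` acts on `L²(G)` as a nonzero convolution operator inside a commutative C*-algebra
that contains the translations `τ_x`. Some character `φ` of this algebra does not vanish at the
operator, and `x ↦ φ(τ_x)` then gives a character of `G` at which `f` has a nonzero coefficient.

The line is dense in its Bohr compactification because the Haar measures of the whole group and of
the closure of the image agree on trigonometric polynomials, hence on all continuous functions. -/

noncomputable section

/-! ### Uniqueness of Fourier coefficients via Gelfand theory -/

section FourierUniqueness

variable {G : Type*} [CommGroup G] [TopologicalSpace G] [IsTopologicalGroup G] [CompactSpace G]
  [T2Space G] [MeasurableSpace G] [BorelSpace G]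

instance fact_one_ne_top : Fact ((1 : ℝ≥0∞) ≠ ∞) := ⟨ENNReal.one_ne_top⟩
instance fact_two_ne_top : Fact ((2 : ℝ≥0∞) ≠ ∞) := ⟨ENNReal.ofNat_ne_top⟩

variable (G) in
/-- The Hilbert space `L²(G)`. -/
abbrev haarL2 : Type _ := Lp ℂ 2 (compactHaar G)

/-- The translation operator `h ↦ h(x ·)` on `L²(G)`. -/
def translationOp (x : G) : haarL2 G →L[ℂ] haarL2 G :=
  LinearMap.mkContinuous
    { toFun := fun h => DomMulAct.mk x • h
      map_add' := fun h k => smul_add _ h k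
      map_smul' := fun c h => smul_comm _ c h } 1
    (fun h => by simp [DomMulAct.norm_smul_Lp])

theorem translationOp_apply (x : G) (h : haarL2 G) :
    translationOp x h = DomMulAct.mk x • h := rfl

theorem translationOp_one : translationOp (1 : G) = 1 := by
  ext1 h
  simp [translationOp_apply]

theorem translationOp_mul (x y : G) :
    translationOp (x * y) = translationOp x * translationOp y := by
  ext1 h
  simp [translationOp_apply, mul_comm x y, mul_smul]

theorem norm_translationOp_apply (x : G) (h : haarL2 G) : ‖translationOp x h‖ = ‖h‖ :=
  DomMulAct.norm_smul_Lp _ h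

/-- Translations are invertible isometries: the adjoint is a left inverse, the inverse translation a
right inverse. -/
theorem star_translationOp (x : G) : star (translationOp x) = translationOp x⁻¹ := by
  have h1 : star (translationOp x) * translationOp x = 1 :=
    (ContinuousLinearMap.norm_map_iff_adjoint_comp_self _).1 (norm_translationOp_apply x)
  have h2 : translationOp x * translationOp x⁻¹ = 1 := by
    rw [← translationOp_mul, mul_inv_cancel, translationOp_one]
  exact left_inv_eq_right_inv h1 h2

theorem continuous_translationOp_apply (h : haarL2 G) :
    Continuous fun x : G => translationOp x h :=
  (DomMulAct.continuous_mk (M := G)).smul continuous_const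

theorem integrable_smul_translationOp {f : G → ℂ} (hf : Integrable f (compactHaar G))
    (h : haarL2 G) : Integrable (fun x => f x • translationOp x h) (compactHaar G) := by
  refine hf.smul_bdd ‖h‖ ?_ (.of_forall fun x => (norm_translationOp_apply x h).le)
  exact ((continuous_translationOp_apply h).stronglyMeasurable_of_hasCompactSupport
    (HasCompactSupport.of_compactSpace _)).aestronglyMeasurable

/-- The convolution operator `h ↦ ∫ f(x) h(x ·) dx` on `L²(G)`, for `f ∈ L¹(G)`. -/
def convolutionOp : Lp ℂ 1 (compactHaar G) →L[ℂ] haarL2 G →L[ℂ] haarL2 G :=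
  LinearMap.mkContinuous₂
    (LinearMap.mk₂ ℂ (fun f h => ∫ x, f x • translationOp x h ∂(compactHaar G))
      (fun f g h => by
        rw [← integral_add (integrable_smul_translationOp (L1.integrable_coeFn f) h)
          (integrable_smul_translationOp (L1.integrable_coeFn g) h)]
        refine integral_congr_ae ?_
        filter_upwards [Lp.coeFn_add f g] with x hx
        rw [hx, Pi.add_apply, add_smul])
      (fun c f h => by
        rw [← integral_smul]
        refine integral_congr_ae ?_
        filter_upwards [Lp.coeFn_smul c f] with x hx
        rw [hx, Pi.smul_apply, smul_assoc])
      (fun f h k => by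
        rw [← integral_add (integrable_smul_translationOp (L1.integrable_coeFn f) h)
          (integrable_smul_translationOp (L1.integrable_coeFn f) k)]
        simp only [map_add, smul_add])
      (fun c f h => by
        rw [← integral_smul]
        simp only [map_smul]
        simp_rw [smul_comm c])) 1
    (fun f h => by
      refine (norm_integral_le_integral_norm _).trans ?_
      simp only [norm_smul, norm_translationOp_apply]
      rw [integral_mul_const, one_mul, L1.norm_eq_integral_norm])

theorem convolutionOp_apply (f : Lp ℂ 1 (compactHaar G)) (h : haarL2 G) :
    convolutionOp f h = ∫ x, f x • translationOp x h ∂(compactHaar G) := rfl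

theorem translationOp_mul_convolutionOp (y : G) (f : Lp ℂ 1 (compactHaar G)) :
    translationOp y * convolutionOp f = convolutionOp (DomMulAct.mk y⁻¹ • f) := by
  ext1 h
  have hf : ∀ᵐ x ∂(compactHaar G), (DomMulAct.mk y⁻¹ • f) x = f (y⁻¹ * x) :=
    DomMulAct.smul_Lp_ae_eq (DomMulAct.mk y⁻¹) f
  rw [mul_apply_eq_comp, convolutionOp_apply, convolutionOp_apply,
    ← ContinuousLinearMap.integral_comp_comm _
      (integrable_smul_translationOp (L1.integrable_coeFn f) h),
    -- Substituting `y⁻¹ x` for `x` turns `τ_y τ_x` into `τ_x` and shifts `f` instead.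
    ← integral_mul_left_eq_self _ y⁻¹]
  refine integral_congr_ae ?_
  filter_upwards [hf] with x hx
  rw [hx, map_smul, ← mul_apply_eq_comp, ← translationOp_mul, mul_inv_cancel_left]

/-- Continuity here is in operator norm, whereas `y ↦ translationOp y` is only known to be strongly
continuous. The translation moves onto `f`, and translation is continuous in `L¹`. -/
theorem continuous_translationOp_mul_convolutionOp (f : Lp ℂ 1 (compactHaar G)) :
    Continuous fun y : G => translationOp y * convolutionOp f := by
  simp_rw [translationOp_mul_convolutionOp]
  exact convolutionOp.continuous.comp
    (((DomMulAct.continuous_mk (M := G)).comp continuous_inv).smul continuous_const)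

variable (G) in
/-- The von Neumann algebra generated by the translation operators on `L²(G)`. -/
def translationAlgebra : StarSubalgebra ℂ (haarL2 G →L[ℂ] haarL2 G) :=
  StarSubalgebra.centralizer ℂ
    (StarSubalgebra.centralizer ℂ (Set.range (translationOp (G := G))) :
      Set (haarL2 G →L[ℂ] haarL2 G))

theorem translationOp_mem_translationAlgebra (x : G) :
    translationOp x ∈ translationAlgebra G := by
  refine (StarSubalgebra.mem_centralizer_iff ℂ).2 fun g hg => ?_
  have hg' := hg
  rw [SetLike.mem_coe] at hg hg'
  have h1 := ((StarSubalgebra.mem_centralizer_iff ℂ).1 hg _ ⟨x, rfl⟩).1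
  have h2 := ((StarSubalgebra.mem_centralizer_iff ℂ).1 (star_mem hg) _ ⟨x, rfl⟩).1
  exact ⟨h1.symm, h2.symm⟩

/-- An operator that commutes with all translations can be pulled through the integral defining the
convolution. -/
theorem convolutionOp_mem_translationAlgebra (f : Lp ℂ 1 (compactHaar G)) :
    convolutionOp f ∈ translationAlgebra G := by
  have key : ∀ g ∈ StarSubalgebra.centralizer ℂ (Set.range (translationOp (G := G))),
      g * convolutionOp f = convolutionOp f * g := by
    intro g hg
    ext1 h
    rw [mul_apply_eq_comp, mul_apply_eq_comp, convolutionOp_apply,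
      convolutionOp_apply, ← ContinuousLinearMap.integral_comp_comm _
        (integrable_smul_translationOp (L1.integrable_coeFn f) h)]
    refine integral_congr_ae (.of_forall fun x => ?_)
    have h1 := ((StarSubalgebra.mem_centralizer_iff ℂ).1 hg _ ⟨x, rfl⟩).1
    change g (f x • translationOp x h) = f x • translationOp x (g h)
    rw [map_smul, ← mul_apply_eq_comp, ← h1, mul_apply_eq_comp]
  exact (StarSubalgebra.mem_centralizer_iff ℂ).2 fun g hg => ⟨key g hg, key _ (star_mem hg)⟩

/-- Since `G` is abelian, the translations and their adjoints lie in their own commutant. The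
bicommutant is thus contained in the commutant, so its elements commute with each other. -/
theorem translationAlgebra_mul_comm {a b : haarL2 G →L[ℂ] haarL2 G}
    (ha : a ∈ translationAlgebra G) (hb : b ∈ translationAlgebra G) : a * b = b * a := by
  refine ((StarSubalgebra.mem_centralizer_iff ℂ).1 hb a ?_).1
  refine (StarSubalgebra.mem_centralizer_iff ℂ).2 ?_
  have key : ∀ x : G, translationOp x * a = a * translationOp x := by
    intro x
    refine ((StarSubalgebra.mem_centralizer_iff ℂ).1 ha _ ?_).1
    refine (StarSubalgebra.mem_centralizer_iff ℂ).2 ?_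
    rintro _ ⟨y, rfl⟩
    rw [star_translationOp, ← translationOp_mul, ← translationOp_mul, ← translationOp_mul,
      ← translationOp_mul, mul_comm x, mul_comm x]
    exact ⟨rfl, rfl⟩
  rintro _ ⟨x, rfl⟩
  rw [star_translationOp]
  exact ⟨key x, key _⟩

theorem isClosed_translationAlgebra :
    IsClosed (translationAlgebra G : Set (haarL2 G →L[ℂ] haarL2 G)) := by
  rw [translationAlgebra, StarSubalgebra.coe_centralizer]
  exact Set.isClosed_centralizer _

instance : CompleteSpace (translationAlgebra G) :=
  (isClosed_translationAlgebra (G := G)).completeSpace_coe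

instance : CommCStarAlgebra (translationAlgebra G) where
  mul_comm a b := Subtype.ext (translationAlgebra_mul_comm a.2 b.2)

/-- An integrable function on a compact Hausdorff space that annihilates all continuous functions
vanishes almost everywhere. -/
theorem ae_eq_zero_of_forall_integral_mul_continuous_eq_zero {X : Type*} [TopologicalSpace X]
    [CompactSpace X] [T2Space X] [MeasurableSpace X] [BorelSpace X] {μ : Measure X}
    [IsFiniteMeasure μ] [μ.Regular] {f : X → ℂ} (hf : Integrable f μ)
    (h : ∀ k : C(X, ℂ), ∫ x, f x * k x ∂μ = 0) : f =ᵐ[μ] 0 := by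
  refine ae_eq_zero_of_forall_setIntegral_isClosed_eq_zero hf fun s hs => ?_
  -- A Urysohn function that is `1` on `s` and `0` off `U n` replaces the indicator of `s` at the
  -- cost of the integral of `‖f‖` over `U n \ s`, which tends to zero.
  have hU : ∀ n : ℕ, ∃ U, U ⊇ s ∧ IsOpen U ∧ μ U < ∞ ∧ μ (U \ s) < ((n : ℝ≥0∞) + 1)⁻¹ :=
    fun n => hs.measurableSet.exists_isOpen_sdiff_lt (measure_ne_top μ s) (by simp)
  choose U hsU hUo _ hUlt using hU
  have hlim : Filter.Tendsto (fun n => μ (U n \ s)) Filter.atTop (nhds 0) := by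
    refine tendsto_of_tendsto_of_tendsto_of_le_of_le tendsto_const_nhds
      ((Filter.tendsto_add_atTop_iff_nat 1).2 ENNReal.tendsto_inv_nat_nhds_zero)
      (fun _ => zero_le) (fun n => ?_)
    simpa using (hUlt n).le
  have hlim' : Filter.Tendsto (fun n => ∫ x in U n \ s, ‖f x‖ ∂μ) Filter.atTop (nhds 0) :=
    hf.norm.tendsto_setIntegral_nhds_zero hlim
  have hbound : ∀ n, ‖∫ x in s, f x ∂μ‖ ≤ ∫ x in U n \ s, ‖f x‖ ∂μ := by
    intro n
    obtain ⟨k, hk0, hk1, hk⟩ := exists_continuous_zero_one_of_isClosed (hUo n).isClosed_compl hs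
      (Set.disjoint_compl_left_iff_subset.2 (hsU n))
    have h0 := h ⟨fun x => (k x : ℂ), Complex.continuous_ofReal.comp k.continuous⟩
    have hint : Integrable (fun x => f x * (k x : ℂ)) μ := by
      refine hf.mul_bdd (c := 1) (Complex.continuous_ofReal.comp
        k.continuous).measurable.aestronglyMeasurable (.of_forall fun x => ?_)
      simpa [abs_of_nonneg (hk x).1] using (hk x).2
    have hm : MeasurableSet (U n \ s) := (hUo n).measurableSet.diff hs.measurableSet
    rw [← integral_indicator hs.measurableSet, ← integral_indicator hm,
      ← sub_zero (∫ x, s.indicator f x ∂μ), ← h0]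
    simp only [ContinuousMap.coe_mk]
    rw [← integral_sub (hf.indicator hs.measurableSet) hint]
    refine (norm_integral_le_integral_norm _).trans ?_
    refine integral_mono_of_nonneg (.of_forall fun x => norm_nonneg _)
      (hf.norm.indicator hm) (.of_forall fun x => ?_)
    by_cases hxs : x ∈ s
    · have : k x = 1 := hk1 hxs
      simp [hxs, this]
    · by_cases hxU : x ∈ U n
      · have h1 : ‖f x‖ * |k x| ≤ ‖f x‖ := by
          rw [abs_of_nonneg (hk x).1]
          exact mul_le_of_le_one_right (norm_nonneg _) (hk x).2
        simpa [hxs, hxU] using h1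
      · have : k x = 0 := hk0 hxU
        simp [hxs, hxU, this]
  exact norm_le_zero_iff.1 (ge_of_tendsto' hlim' hbound)

theorem translationOp_toLp (x : G) (k : C(G, ℂ)) :
    translationOp x (ContinuousMap.toLp 2 (compactHaar G) ℂ k) =
      ContinuousMap.toLp 2 (compactHaar G) ℂ (k.comp (ContinuousMap.mulLeft x)) := by
  rw [translationOp_apply]
  refine Lp.ext ?_
  have h1 : ∀ᵐ y ∂(compactHaar G), (DomMulAct.mk x • ContinuousMap.toLp 2 (compactHaar G) ℂ k) y =
      ContinuousMap.toLp 2 (compactHaar G) ℂ k (x * y) := DomMulAct.smul_Lp_ae_eq _ _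
  have h2 := (measurePreserving_mul_left (compactHaar G) x).quasiMeasurePreserving.ae
    (ContinuousMap.coeFn_toLp (p := 2) (compactHaar G) (𝕜 := ℂ) k)
  filter_upwards [h1, h2, ContinuousMap.coeFn_toLp (p := 2) (compactHaar G) (𝕜 := ℂ)
    (k.comp (ContinuousMap.mulLeft x))] with y h1 h2 h3
  rw [h1, h2, h3]
  rfl

/-- Applied to a continuous `k`, the operator yields the continuous function `y ↦ ∫ f(x) k(xy) dx`.
If this vanishes in `L²`, it vanishes everywhere, and its value at `y = 1` is `∫ f k`. -/
theorem eq_zero_of_convolutionOp_eq_zero {f : Lp ℂ 1 (compactHaar G)}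
    (hf : convolutionOp f = 0) : f = 0 := by
  have hfi := L1.integrable_coeFn f
  refine Lp.ext ?_
  refine (ae_eq_zero_of_forall_integral_mul_continuous_eq_zero hfi fun k => ?_).trans
    (Lp.coeFn_zero ℂ 1 (compactHaar G)).symm
  -- The integral is formed in `C(G, ℂ)`, so that evaluation at a point is a continuous functional.
  let F : C(G, C(G, ℂ)) :=
    ContinuousMap.curry ⟨fun q : G × G => k (q.1 * q.2), by fun_prop⟩
  have hF : Integrable (fun x => f x • F x) (compactHaar G) := by
    refine hfi.smul_bdd ‖F‖ ?_ (.of_forall fun x => F.norm_coe_le_norm x)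
    exact (F.continuous.stronglyMeasurable_of_hasCompactSupport
      (HasCompactSupport.of_compactSpace _)).aestronglyMeasurable
  have h1 : ContinuousMap.toLp 2 (compactHaar G) ℂ (∫ x, f x • F x ∂(compactHaar G)) = 0 := by
    rw [← ContinuousLinearMap.integral_comp_comm _ hF]
    have h2 := DFunLike.congr_fun hf (ContinuousMap.toLp 2 (compactHaar G) ℂ k)
    rw [convolutionOp_apply] at h2
    simp_rw [translationOp_toLp] at h2
    simp only [map_smul]
    exact h2
  have h3 : ∫ x, f x • F x ∂(compactHaar G) = 0 :=
    ContinuousMap.toLp_injective (compactHaar G) (h1.trans (map_zero _).symm)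
  have h4 := congrArg (ContinuousMap.evalCLM ℂ (1 : G)) h3
  rw [← ContinuousLinearMap.integral_comp_comm _ hF] at h4
  simpa [F] using h4

/-- If a character `φ` of the translation algebra does not vanish at some convolution operator,
then its restriction to the translations is continuous. -/
theorem continuous_character_translationOp {f : Lp ℂ 1 (compactHaar G)}
    {φ : WeakDual.characterSpace ℂ (translationAlgebra G)}
    (hφ : φ ⟨convolutionOp f, convolutionOp_mem_translationAlgebra f⟩ ≠ 0) :
    Continuous fun x : G => φ ⟨translationOp x, translationOp_mem_translationAlgebra x⟩ := by
  have h : Continuous fun x : G => φ (⟨translationOp x, translationOp_mem_translationAlgebra x⟩ *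
      ⟨convolutionOp f, convolutionOp_mem_translationAlgebra f⟩) :=
    (map_continuous φ).comp
      ((continuous_translationOp_mul_convolutionOp f).subtype_mk _)
  simp only [map_mul] at h
  simpa [hφ] using h.div_const (φ ⟨convolutionOp f, convolutionOp_mem_translationAlgebra f⟩)

theorem character_translationOp_inv (φ : WeakDual.characterSpace ℂ (translationAlgebra G))
    (x : G) :
    φ ⟨translationOp x⁻¹, translationOp_mem_translationAlgebra x⁻¹⟩ =
      (starRingEnd ℂ) (φ ⟨translationOp x, translationOp_mem_translationAlgebra x⟩) := by
  have h : (⟨translationOp x⁻¹, translationOp_mem_translationAlgebra x⁻¹⟩ : translationAlgebra G) =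
      star ⟨translationOp x, translationOp_mem_translationAlgebra x⟩ :=
    Subtype.ext (star_translationOp x).symm
  rw [h, map_star]
  rfl

/-- The homomorphism `x ↦ φ(τ_x)` induced by a character `φ` of the translation algebra. -/
def translationCharacter (φ : WeakDual.characterSpace ℂ (translationAlgebra G)) : G →* ℂ where
  toFun x := φ ⟨translationOp x, translationOp_mem_translationAlgebra x⟩
  map_one' := (congrArg φ (Subtype.ext translationOp_one)).trans (map_one φ)
  map_mul' x y := (congrArg φ (Subtype.ext (translationOp_mul x y))).trans (map_mul φ _ _)

theorem translationCharacter_inv (φ : WeakDual.characterSpace ℂ (translationAlgebra G)) (x : G) :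
    translationCharacter φ x⁻¹ = (starRingEnd ℂ) (translationCharacter φ x) :=
  character_translationOp_inv φ x

theorem translationCharacter_mem_circle (φ : WeakDual.characterSpace ℂ (translationAlgebra G))
    (x : G) : translationCharacter φ x ∈ Submonoid.unitSphere ℂ := by
  have h1 : translationCharacter φ x * (starRingEnd ℂ) (translationCharacter φ x) = 1 := by
    rw [← translationCharacter_inv, ← map_mul, mul_inv_cancel, map_one]
  rw [Complex.mul_conj, Complex.ofReal_eq_one, Complex.normSq_eq_norm_sq] at h1
  exact mem_sphere_zero_iff_norm.2 (by nlinarith [norm_nonneg (translationCharacter φ x)])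

/-- `φ` is only norm continuous and need not commute with the strong integral of the translations.
After multiplication by `a = convolutionOp f` the integrand is norm continuous, so `φ` passes
through the integral for `a * a`, and `φ a` is cancelled. -/
theorem character_convolutionOp {f : Lp ℂ 1 (compactHaar G)}
    {φ : WeakDual.characterSpace ℂ (translationAlgebra G)}
    (hφ : φ ⟨convolutionOp f, convolutionOp_mem_translationAlgebra f⟩ ≠ 0) :
    φ ⟨convolutionOp f, convolutionOp_mem_translationAlgebra f⟩ =
      ∫ x, f x * translationCharacter φ x ∂(compactHaar G) := by
  set a : translationAlgebra G := ⟨convolutionOp f, convolutionOp_mem_translationAlgebra f⟩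
  let v : C(G, translationAlgebra G) :=
    ⟨fun x => ⟨translationOp x, translationOp_mem_translationAlgebra x⟩ * a,
      (continuous_translationOp_mul_convolutionOp f).subtype_mk _⟩
  have hint : Integrable (fun x => f x • v x) (compactHaar G) := by
    refine (L1.integrable_coeFn f).smul_bdd ‖v‖ ?_ (.of_forall fun x => v.norm_coe_le_norm x)
    exact (v.continuous.stronglyMeasurable_of_hasCompactSupport
      (HasCompactSupport.of_compactSpace _)).aestronglyMeasurable
  have hsq : a * a = ∫ x, f x • v x ∂(compactHaar G) := by
    let ι : translationAlgebra G →L[ℂ] haarL2 G →L[ℂ] haarL2 G :=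
      (translationAlgebra G).toSubalgebra.toSubmodule.subtypeL
    have h1 : ι (∫ x, f x • v x ∂(compactHaar G)) = ∫ x, ι (f x • v x) ∂(compactHaar G) :=
      (ι.integral_comp_comm hint).symm
    refine Subtype.ext (Eq.trans ?_ h1.symm)
    ext1 h
    rw [ContinuousLinearMap.integral_apply (ι.integrable_comp hint)]
    exact convolutionOp_apply f (convolutionOp f h)
  refine mul_right_cancel₀ hφ ?_
  rw [← map_mul, hsq, ← integral_mul_const]
  refine ((WeakDual.CharacterSpace.toCLM φ).integral_comp_comm hint).symm.trans ?_
  refine integral_congr_ae (.of_forall fun x => ?_)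
  refine (map_smul (WeakDual.CharacterSpace.toCLM φ) (f x) (v x)).trans ?_
  have h2 : (WeakDual.CharacterSpace.toCLM φ) (v x) = translationCharacter φ x * φ a :=
    map_mul φ _ _
  rw [h2, smul_eq_mul, ← mul_assoc]

theorem exists_haarFourierCoeff_ne_zero {f : Lp ℂ 1 (compactHaar G)} (hf : f ≠ 0) :
    ∃ γ : PontryaginDual G, haarFourierCoeff f γ ≠ 0 := by
  set a : translationAlgebra G := ⟨convolutionOp f, convolutionOp_mem_translationAlgebra f⟩
  have ha0 : a ≠ 0 := fun h => hf (eq_zero_of_convolutionOp_eq_zero (congrArg Subtype.val h))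
  obtain ⟨φ, hφ⟩ : ∃ φ : WeakDual.characterSpace ℂ (translationAlgebra G), φ a ≠ 0 := by
    by_contra! h
    refine ha0 ((gelfandTransform_isometry (translationAlgebra G)).injective ?_)
    ext φ
    simpa using h φ
  -- The inverse compensates for the conjugate in the Fourier coefficient.
  let γ : PontryaginDual G :=
    ({ toFun := fun x => ⟨translationCharacter φ x⁻¹, translationCharacter_mem_circle φ _⟩
       map_one' := Subtype.ext (by simp)
       map_mul' := fun x y => Subtype.ext (by
        change translationCharacter φ (x * y)⁻¹ = _ * _
        rw [mul_inv, map_mul])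
       continuous_toFun := ((continuous_character_translationOp hφ).comp
        continuous_inv).subtype_mk _ } : G →ₜ* Circle)
  have hγ : ∀ x, (γ x : ℂ) = translationCharacter φ x⁻¹ := fun _ => rfl
  refine ⟨γ, fun h0 => hφ ?_⟩
  rw [character_convolutionOp hφ, ← h0]
  refine integral_congr_ae (.of_forall fun x => ?_)
  simp only [hγ]
  rw [← translationCharacter_inv, inv_inv]

/-- Uniqueness of Fourier coefficients on compact abelian groups. -/
theorem ae_eq_of_haarFourierCoeff_eq {f g : G → ℂ} (hf : Integrable f (compactHaar G))
    (hg : Integrable g (compactHaar G))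
    (h : ∀ γ : PontryaginDual G, haarFourierCoeff f γ = haarFourierCoeff g γ) :
    f =ᵐ[compactHaar G] g := by
  have h1 : hf.toL1 f - hg.toL1 g = 0 := by
    by_contra h0
    obtain ⟨γ, hγ⟩ := exists_haarFourierCoeff_ne_zero h0
    refine hγ ?_
    have hc : Continuous fun x => (starRingEnd ℂ) (γ x : ℂ) :=
      Complex.continuous_conj.comp (continuous_subtype_val.comp (map_continuous γ))
    have hb : ∀ k : G → ℂ, Integrable k (compactHaar G) →
        Integrable (fun x => k x * (starRingEnd ℂ) (γ x : ℂ)) (compactHaar G) := fun k hk =>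
      hk.mul_bdd (c := 1) hc.measurable.aestronglyMeasurable
        (.of_forall fun x => by simp [Circle.norm_coe])
    rw [← sub_eq_zero.2 (h γ)]
    unfold haarFourierCoeff
    rw [← integral_sub (hb f hf) (hb g hg)]
    refine integral_congr_ae ?_
    filter_upwards [Lp.coeFn_sub (hf.toL1 f) (hg.toL1 g), hf.coeFn_toL1, hg.coeFn_toL1]
      with x h1 h2 h3
    rw [h1, Pi.sub_apply, h2, h3, sub_mul]
  exact (Integrable.toL1_eq_toL1_iff f g hf hg).1 (sub_eq_zero.1 h1)

end FourierUniqueness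

/-! ### Hardy spaces and quotient homomorphisms -/

section Quotient

variable {K : Type*} [CommGroup K] [TopologicalSpace K] [IsTopologicalGroup K] [CompactSpace K]
  [T2Space K] [MeasurableSpace K] [BorelSpace K]
  {G : Type*} [CommGroup G] [TopologicalSpace G] [IsTopologicalGroup G] [CompactSpace G]
  [T2Space G] [MeasurableSpace G] [BorelSpace G]

theorem measurePreserving_of_surjective {q : K →ₜ* G} (hq : Function.Surjective q) :
    MeasurePreserving q (compactHaar K) (compactHaar G) :=
  MonoidHom.measurePreserving (f := q.toMonoidHom) q.continuous_toFun hq (by simp)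

theorem haarFourierCoeff_congr_ae {f g : G → ℂ} (h : f =ᵐ[compactHaar G] g)
    (γ : PontryaginDual G) : haarFourierCoeff f γ = haarFourierCoeff g γ := by
  refine integral_congr_ae ?_
  filter_upwards [h] with x hx
  rw [hx]

theorem measurable_conj_char (γ : PontryaginDual G) :
    Measurable fun x => (starRingEnd ℂ) (γ x : ℂ) :=
  (Complex.continuous_conj.comp (continuous_subtype_val.comp (map_continuous γ))).measurable

theorem haarFourierCoeff_comp_map {q : K →ₜ* G} (hq : Function.Surjective q) {f : G → ℂ}
    (hf : AEStronglyMeasurable f (compactHaar G)) (γ : PontryaginDual G) :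
    haarFourierCoeff (f ∘ q) (PontryaginDual.map q γ) = haarFourierCoeff f γ := by
  have hm := measurePreserving_of_surjective hq
  have h := integral_map (μ := compactHaar K) hm.measurable.aemeasurable
    (f := fun x => f x * (starRingEnd ℂ) (γ x : ℂ))
    (by
      rw [hm.map_eq]
      exact hf.mul (measurable_conj_char γ).aestronglyMeasurable)
  rw [hm.map_eq] at h
  exact h.symm

/-- A character that is trivial on the kernel of a surjective homomorphism factors through it. -/
theorem mem_range_map_of_ker {q : K →ₜ* G} (hq : Function.Surjective q) {χ : PontryaginDual K}
    (h : ∀ k, q k = 1 → χ k = 1) : χ ∈ Set.range (PontryaginDual.map q) := by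
  -- A continuous map from a compact to a Hausdorff space is closed, so continuity of the factored
  -- character can be tested on `K`.
  have hquot : Topology.IsQuotientMap q :=
    (map_continuous q).isClosedMap.isQuotientMap (map_continuous q) hq
  choose s hs using hq
  have hfac : ∀ x y, q x = q y → χ x = χ y := by
    intro x y hxy
    have h1 := h (x / y) (by rw [map_div, hxy, div_self'])
    rwa [map_div, div_eq_one] at h1
  have hcomp : (fun g => χ (s g)) ∘ q = χ := funext fun x => hfac _ _ (hs _)
  refine ⟨({ toFun := fun g => χ (s g)
             map_one' := by
              rw [hfac (s 1) 1 (by rw [hs, map_one]), map_one]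
             map_mul' := fun x y => by
              rw [hfac (s (x * y)) (s x * s y) (by simp only [map_mul, hs]), map_mul]
             continuous_toFun := by
              refine hquot.continuous_iff.2 ?_
              rw [hcomp]
              exact map_continuous χ } : G →ₜ* Circle), ?_⟩
  exact PontryaginDual.ext fun x => congrFun hcomp x

/-- Such a `χ` is nontrivial at some `k` in the kernel of `q`. Translation by `k` fixes `f ∘ q` but
multiplies the coefficient by the conjugate of `χ k`, which is not `1`. -/
theorem haarFourierCoeff_comp_eq_zero {q : K →ₜ* G} (hq : Function.Surjective q) (f : G → ℂ)
    {χ : PontryaginDual K} (hχ : χ ∉ Set.range (PontryaginDual.map q)) :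
    haarFourierCoeff (f ∘ q) χ = 0 := by
  obtain ⟨k, hk, hk1⟩ : ∃ k, q k = 1 ∧ χ k ≠ 1 := by
    by_contra! h
    exact hχ (mem_range_map_of_ker hq h)
  have h1 : haarFourierCoeff (f ∘ q) χ =
      (starRingEnd ℂ) (χ k : ℂ) * haarFourierCoeff (f ∘ q) χ := by
    unfold haarFourierCoeff
    rw [← integral_const_mul, ← integral_mul_left_eq_self _ k]
    refine integral_congr_ae (.of_forall fun x => ?_)
    simp only [Function.comp_apply, map_mul, hk, one_mul, Circle.coe_mul]
    ring
  by_contra h0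
  have h2 : (starRingEnd ℂ) (χ k : ℂ) = 1 := mul_right_cancel₀ h0 (by rw [← h1, one_mul])
  refine hk1 (Circle.ext ?_)
  have h3 := congrArg (starRingEnd ℂ) h2
  simpa using h3

/-- An integrable function whose Fourier coefficients are supported in the range of the dual of a
surjective homomorphism factors through that homomorphism. -/
theorem exists_ae_eq_comp {q : K →ₜ* G} (hq : Function.Surjective q) {F : K → ℂ}
    (hF : Integrable F (compactHaar K))
    (h : ∀ χ, haarFourierCoeff F χ ≠ 0 → χ ∈ Set.range (PontryaginDual.map q)) :
    ∃ g : G → ℂ, StronglyMeasurable g ∧ F =ᵐ[compactHaar K] g ∘ q := by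
  have hm := measurePreserving_of_surjective hq
  have hle : MeasurableSpace.comap q inferInstance ≤ (inferInstance : MeasurableSpace K) :=
    hm.measurable.comap_le
  -- The candidate is the conditional expectation of `F` on the σ-algebra pulled back along `q`.
  obtain ⟨g, hg, hEg⟩ := (stronglyMeasurable_condExp (μ := compactHaar K) (f := F)
    (m := MeasurableSpace.comap q inferInstance)).exists_eq_measurable_comp
  refine ⟨g, hg, ?_⟩
  refine ae_eq_of_haarFourierCoeff_eq hF (hEg ▸ integrable_condExp) fun χ => ?_
  by_cases hχ : χ ∈ Set.range (PontryaginDual.map q)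
  · obtain ⟨γ, rfl⟩ := hχ
    rw [← hEg]
    unfold haarFourierCoeff
    rw [← integral_condExp hle]
    refine integral_congr_ae ?_
    -- The character `γ ∘ q` is measurable for the smaller σ-algebra and can be pulled out of the
    -- conditional expectation.
    refine condExp_bilin_of_stronglyMeasurable_right (ContinuousLinearMap.mul ℝ ℂ) ?_ ?_ hF
    · exact ((measurable_conj_char γ).comp (comap_measurable q)).stronglyMeasurable
    · exact hF.mul_bdd (c := 1) (measurable_conj_char _).aestronglyMeasurable
        (.of_forall fun x => by simp [Circle.norm_coe])
  · rw [haarFourierCoeff_comp_eq_zero hq g hχ]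
    exact not_not.1 (mt (h χ) hχ)

theorem IsLambdaDirichletGroup.of_surjective {lam : ℕ → ℝ} {β : Multiplicative ℝ →ₜ* G}
    {α : Multiplicative ℝ →ₜ* K} (hβ : IsLambdaDirichletGroup lam β) {q : K →ₜ* G}
    (hqα : ∀ t, q (α t) = β t) (hα : IsDirichletGroup α) : IsLambdaDirichletGroup lam α where
  isDirichletGroup := hα
  mem_range n := by
    obtain ⟨γ, hγ⟩ := hβ.mem_range n
    refine ⟨PontryaginDual.map q γ, hγ ▸ PontryaginDual.ext fun t => ?_⟩
    simp [hqα]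

theorem map_extChar {lam : ℕ → ℝ} {β : Multiplicative ℝ →ₜ* G} {α : Multiplicative ℝ →ₜ* K}
    (hβ : IsLambdaDirichletGroup lam β) (hα : IsLambdaDirichletGroup lam α) {q : K →ₜ* G}
    (hqα : ∀ t, q (α t) = β t) (n : ℕ) :
    PontryaginDual.map q (extChar β (lam n)) = extChar α (lam n) := by
  rw [← hα.map_eq_iff, ← (hβ.map_eq_iff n _).2 rfl]
  exact PontryaginDual.ext fun t => by simp [hqα]

variable (p : ℝ≥0∞) [hp : Fact (1 ≤ p)]

/-- Two Dirichlet groups for the same frequency have the same Hardy space if one of them is a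
quotient of the other one. -/
theorem exists_hardy_equiv_of_surjective {lam : ℕ → ℝ} {β : Multiplicative ℝ →ₜ* G}
    {α : Multiplicative ℝ →ₜ* K} (hβ : IsLambdaDirichletGroup lam β)
    (hα : IsLambdaDirichletGroup lam α) {q : K →ₜ* G} (hq : Function.Surjective q)
    (hqα : ∀ t, q (α t) = β t) :
    ∃ Ψ : lambdaHardySpace p lam β ≃ₗᵢ[ℂ] lambdaHardySpace p lam α,
      ∀ (f : lambdaHardySpace p lam β) (n : ℕ),
        haarFourierCoeff (f : Lp ℂ p (compactHaar G)) (extChar β (lam n)) =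
          haarFourierCoeff (Ψ f : Lp ℂ p (compactHaar K)) (extChar α (lam n)) := by
  have hm := measurePreserving_of_surjective hq
  let T : Lp ℂ p (compactHaar G) →ₗᵢ[ℂ] Lp ℂ p (compactHaar K) :=
    Lp.compMeasurePreservingₗᵢ ℂ q hm
  have hT : ∀ f, T f =ᵐ[compactHaar K] f ∘ q := fun f => Lp.coeFn_compMeasurePreserving f hm
  have hcoeff : ∀ f γ, haarFourierCoeff (T f) (PontryaginDual.map q γ) = haarFourierCoeff f γ :=
    fun f γ => (haarFourierCoeff_congr_ae (hT f) _).trans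
      (haarFourierCoeff_comp_map hq (Lp.aestronglyMeasurable f) γ)
  have hmem : ∀ f, T f ∈ lambdaHardySpace p lam α ↔ f ∈ lambdaHardySpace p lam β := by
    intro f
    constructor
    · intro h γ hγ
      rw [← hcoeff] at hγ
      obtain ⟨n, hn⟩ := h _ hγ
      refine ⟨n, ((hβ.map_eq_iff n γ).1 ?_).symm⟩
      rw [← (hα.map_eq_iff n _).2 hn.symm]
      exact PontryaginDual.ext fun t => by simp [hqα]
    · intro h χ hχ
      have hχ' : χ ∈ Set.range (PontryaginDual.map q) := by
        by_contra h0
        exact hχ ((haarFourierCoeff_congr_ae (hT f) _).trans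
          (haarFourierCoeff_comp_eq_zero hq _ h0))
      obtain ⟨γ, rfl⟩ := hχ'
      rw [hcoeff] at hχ
      obtain ⟨n, rfl⟩ := h _ hχ
      exact ⟨n, (map_extChar hβ hα hqα n).symm⟩
  let S : lambdaHardySpace p lam β →ₗᵢ[ℂ] lambdaHardySpace p lam α :=
    { toLinearMap := T.toLinearMap.restrict fun f hf => (hmem f).2 hf
      norm_map' := fun f => T.norm_map f }
  have hS : Function.Surjective S := by
    rintro ⟨F, hF⟩
    obtain ⟨g, hg, hFg⟩ := exists_ae_eq_comp hq ((Lp.memLp F).integrable hp.out) fun χ hχ => by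
      obtain ⟨n, rfl⟩ := hF χ hχ
      exact ⟨_, map_extChar hβ hα hqα n⟩
    have hgp : MemLp g p (compactHaar G) := by
      -- Membership in `L_p` is read off upstairs, where `g ∘ q` agrees almost everywhere with `F`.
      rw [← hm.map_eq, memLp_map_measure_iff hg.aestronglyMeasurable hm.measurable.aemeasurable]
      exact (memLp_congr_ae hFg).1 (Lp.memLp F)
    have hTF : T (hgp.toLp g) = F := by
      refine Lp.ext ((hT _).trans ?_)
      exact (hm.quasiMeasurePreserving.ae_eq_comp hgp.coeFn_toLp).trans hFg.symm
    exact ⟨⟨hgp.toLp g, (hmem _).1 (hTF ▸ hF)⟩, Subtype.ext hTF⟩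
  refine ⟨LinearIsometryEquiv.ofSurjective S hS, fun f n => ?_⟩
  rw [← map_extChar hβ hα hqα n]
  exact (hcoeff f _).symm

end Quotient

/-! ### Closures of images of the real line -/

section ClosureRange

variable {G : Type*} [CommGroup G] [TopologicalSpace G] [IsTopologicalGroup G]

/-- The closure of the range of a homomorphism from the real line. -/
abbrev closureRange (β : Multiplicative ℝ →ₜ* G) : Subgroup G :=
  β.toMonoidHom.range.topologicalClosure

theorem isClosed_closureRange (β : Multiplicative ℝ →ₜ* G) :
    IsClosed (closureRange β : Set G) :=
  Subgroup.isClosed_topologicalClosure _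

theorem mem_closureRange (β : Multiplicative ℝ →ₜ* G) (t : Multiplicative ℝ) :
    β t ∈ closureRange β :=
  Subgroup.le_topologicalClosure _ ⟨t, rfl⟩

instance [CompactSpace G] (β : Multiplicative ℝ →ₜ* G) : CompactSpace (closureRange β) :=
  isCompact_iff_compactSpace.1 (isClosed_closureRange β).isCompact

/-- The homomorphism `β`, with values in the closure of its range. -/
def toClosureRange (β : Multiplicative ℝ →ₜ* G) : Multiplicative ℝ →ₜ* closureRange β where
  toFun t := ⟨β t, mem_closureRange β t⟩
  map_one' := Subtype.ext (map_one β)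
  map_mul' s t := Subtype.ext (map_mul β s t)
  continuous_toFun := β.continuous_toFun.subtype_mk _

theorem isDirichletGroup_toClosureRange [CompactSpace G] [T2Space G]
    (β : Multiplicative ℝ →ₜ* G) : IsDirichletGroup (toClosureRange β) := by
  intro x
  rw [Topology.IsInducing.subtypeVal.closure_eq_preimage_closure_image, Set.mem_preimage,
    ← Set.range_comp]
  exact x.2

theorem surjective_of_comp_eq {K : Type*} [TopologicalSpace K] [CompactSpace K] [T2Space G]
    {q : K → G} (hq : Continuous q) {β : Multiplicative ℝ → G} (hβ : DenseRange β)
    {α : Multiplicative ℝ → K} (hqα : ∀ t, q (α t) = β t) : Function.Surjective q := by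
  have h : DenseRange q := hβ.mono (by rintro _ ⟨t, rfl⟩; exact ⟨α t, hqα t⟩)
  rw [← Set.range_eq_univ, ← (isCompact_range hq).isClosed.closure_eq]
  exact h.closure_eq

end ClosureRange

/-! ### Comparison of two Dirichlet groups -/

section Comparison

universe u v

variable (p : ℝ≥0∞) [hp : Fact (1 ≤ p)] {lam : ℕ → ℝ}
  {G : Type*} [CommGroup G] [TopologicalSpace G] [IsTopologicalGroup G] [CompactSpace G]
  [T2Space G] [MeasurableSpace G] [BorelSpace G] {β : Multiplicative ℝ →ₜ* G}
  {H : Type*} [CommGroup H] [TopologicalSpace H] [IsTopologicalGroup H] [CompactSpace H]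
  [T2Space H] [MeasurableSpace H] [BorelSpace H] {β' : Multiplicative ℝ →ₜ* H}

/-- Any two Dirichlet groups are quotients of a third one. -/
theorem exists_common_cover {G : Type u} [CommGroup G] [TopologicalSpace G]
    [IsTopologicalGroup G] [CompactSpace G] [T2Space G] {β : Multiplicative ℝ →ₜ* G}
    {H : Type v} [CommGroup H] [TopologicalSpace H] [IsTopologicalGroup H] [CompactSpace H]
    [T2Space H] {β' : Multiplicative ℝ →ₜ* H}
    (hβ : IsDirichletGroup β) (hβ' : IsDirichletGroup β') :
    ∃ (K : Type (max u v)) (_ : CommGroup K) (_ : TopologicalSpace K) (_ : IsTopologicalGroup K)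
      (_ : CompactSpace K) (_ : T2Space K) (α : Multiplicative ℝ →ₜ* K)
      (q : K →ₜ* G) (q' : K →ₜ* H), IsDirichletGroup α ∧ Function.Surjective q ∧
        Function.Surjective q' ∧ (∀ t, q (α t) = β t) ∧ ∀ t, q' (α t) = β' t := by
  -- The common cover is the closure of the image of `t ↦ (β t, β' t)`.
  let γ : Multiplicative ℝ →ₜ* G × H := β.prod β'
  let q : closureRange γ →ₜ* G :=
    (ContinuousMonoidHom.fst G H).comp ⟨(closureRange γ).subtype, continuous_subtype_val⟩
  let q' : closureRange γ →ₜ* H :=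
    (ContinuousMonoidHom.snd G H).comp ⟨(closureRange γ).subtype, continuous_subtype_val⟩
  exact ⟨closureRange γ, inferInstance, inferInstance, inferInstance, inferInstance,
    inferInstance, toClosureRange γ, q, q', isDirichletGroup_toClosureRange γ,
    surjective_of_comp_eq (map_continuous q) hβ (α := toClosureRange γ) fun _ => rfl,
    surjective_of_comp_eq (map_continuous q') hβ' (α := toClosureRange γ) fun _ => rfl,
    fun _ => rfl, fun _ => rfl⟩

/-- The Hardy spaces of two Dirichlet groups for the same frequency coincide. -/
theorem exists_hardy_equiv (hβ : IsLambdaDirichletGroup lam β)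
    (hβ' : IsLambdaDirichletGroup lam β') :
    ∃ Ψ : lambdaHardySpace p lam β ≃ₗᵢ[ℂ] lambdaHardySpace p lam β',
      ∀ (f : lambdaHardySpace p lam β) (n : ℕ),
        haarFourierCoeff (f : Lp ℂ p (compactHaar G)) (extChar β (lam n)) =
          haarFourierCoeff (Ψ f : Lp ℂ p (compactHaar H)) (extChar β' (lam n)) := by
  obtain ⟨K, _, _, _, _, _, α, q, q', hα, hq, hq', hqα, hqα'⟩ :=
    exists_common_cover hβ.isDirichletGroup hβ'.isDirichletGroup
  let _ : MeasurableSpace K := borel K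
  have : BorelSpace K := ⟨rfl⟩
  have hα' : IsLambdaDirichletGroup lam α := hβ.of_surjective hqα hα
  obtain ⟨Φ, hΦ⟩ := exists_hardy_equiv_of_surjective p hβ hα' hq hqα
  obtain ⟨Φ', hΦ'⟩ := exists_hardy_equiv_of_surjective p hβ' hα' hq' hqα'
  refine ⟨Φ.trans Φ'.symm, fun f n => ?_⟩
  rw [hΦ, hΦ', LinearIsometryEquiv.trans_apply, LinearIsometryEquiv.apply_symm_apply]

theorem bohrMap_injective : Function.Injective (bohrMap p lam β) := by
  intro f g hfg
  refine Subtype.ext (Lp.ext (ae_eq_of_haarFourierCoeff_eq ((Lp.memLp _).integrable hp.out)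
    ((Lp.memLp _).integrable hp.out) fun γ => ?_))
  by_cases hγ : γ ∈ Set.range fun n => extChar β (lam n)
  · obtain ⟨n, rfl⟩ := hγ
    exact congrFun hfg n
  · rw [not_not.1 (mt (f.2 γ) hγ), not_not.1 (mt (g.2 γ) hγ)]

theorem dirichletHardyNorm_bohrMap (f : lambdaHardySpace p lam β) :
    dirichletHardyNorm p lam β (bohrMap p lam β f) = ‖f‖ := by
  have h : {r : ℝ | ∃ g, bohrMap p lam β g = bohrMap p lam β f ∧ ‖g‖ = r} = {‖f‖} := by
    ext r
    constructor
    · rintro ⟨g, hg, rfl⟩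
      rw [bohrMap_injective p hg]
      rfl
    · rintro rfl
      exact ⟨f, rfl, rfl⟩
  rw [dirichletHardyNorm, h, csInf_singleton]

end Comparison

/-! ### Density of the real line in its Bohr compactification -/

section Bohr

/-- The character `b ↦ b(x)` of the Bohr compactification. -/
def bohrEval (x : RealDiscrete) : PontryaginDual BohrCompactification :=
  ({ toFun := fun b => b x
     map_one' := rfl
     map_mul' := fun _ _ => rfl
     continuous_toFun := ContinuousEvalConst.continuous_eval_const
      (F := RealDiscrete →ₜ* Circle) x } : BohrCompactification →ₜ* Circle)

theorem map_bohrEval (x : ℝ) :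
    PontryaginDual.map bohrEmbedding (bohrEval (Multiplicative.ofAdd x)) = realChar x := by
  refine PontryaginDual.ext fun t => ?_
  change Circle.exp (-(t.toAdd * x)) = Circle.exp (-(x * t.toAdd))
  rw [mul_comm]

/-- A non-trivial character has integral zero. -/
theorem integral_char_eq_zero {G : Type*} [CommGroup G] [TopologicalSpace G]
    [IsTopologicalGroup G] [CompactSpace G] [MeasurableSpace G] [BorelSpace G]
    {χ : PontryaginDual G} (hχ : χ ≠ 1) : ∫ x, (χ x : ℂ) ∂(compactHaar G) = 0 := by
  obtain ⟨k, hk⟩ : ∃ k, χ k ≠ 1 := by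
    by_contra! h
    exact hχ (PontryaginDual.ext h)
  have h1 : ∫ x, (χ x : ℂ) ∂(compactHaar G) = χ k * ∫ x, (χ x : ℂ) ∂(compactHaar G) := by
    rw [← integral_const_mul, ← integral_mul_left_eq_self _ k]
    simp
  by_contra h0
  exact hk (Circle.ext (mul_right_cancel₀ h0 (by rw [← h1, Circle.coe_one, one_mul])))

/-- The function `b ↦ b(x)` on the Bohr compactification. -/
def bohrMonomial : RealDiscrete →* C(BohrCompactification, ℂ) where
  toFun x := ⟨fun b => (b x : ℂ), continuous_subtype_val.comp (map_continuous (bohrEval x))⟩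
  map_one' := by ext b; simp
  map_mul' x y := by ext b; simp

/-- The star algebra of trigonometric polynomials on the Bohr compactification. -/
def bohrTrigPoly : StarSubalgebra ℂ C(BohrCompactification, ℂ) where
  toSubalgebra := Algebra.adjoin ℂ (Set.range bohrMonomial)
  star_mem' := by
    change Algebra.adjoin ℂ (Set.range bohrMonomial) ≤
      star (Algebra.adjoin ℂ (Set.range bohrMonomial))
    refine Algebra.adjoin_le ?_
    rintro - ⟨x, rfl⟩
    refine Algebra.subset_adjoin ⟨x⁻¹, ?_⟩
    ext b
    change ((b x⁻¹ : Circle) : ℂ) = (starRingEnd ℂ) (b x : ℂ)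
    rw [map_inv, Circle.coe_inv_eq_conj]

theorem bohrTrigPoly_coe :
    Subalgebra.toSubmodule bohrTrigPoly.toSubalgebra =
      Submodule.span ℂ (Set.range bohrMonomial) := by
  refine Algebra.adjoin_eq_span_of_subset ℂ (Set.Subset.trans ?_ Submodule.subset_span)
  rw [← MonoidHom.coe_mrange, Submonoid.closure_eq]

/-- This is Stone–Weierstrass: the monomials are closed under products and conjugation, and points
of the dual group are separated by their values. -/
theorem dense_span_bohrMonomial :
    (Submodule.span ℂ (Set.range bohrMonomial)).topologicalClosure = ⊤ := by
  rw [← bohrTrigPoly_coe]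
  refine congrArg (Subalgebra.toSubmodule <| StarSubalgebra.toSubalgebra ·)
    (ContinuousMap.starSubalgebra_topologicalClosure_eq_top_of_separatesPoints bohrTrigPoly ?_)
  intro b c hbc
  obtain ⟨x, hx⟩ : ∃ x, b x ≠ c x := by
    by_contra! h
    exact hbc (PontryaginDual.ext h)
  exact ⟨_, ⟨bohrMonomial x, Algebra.subset_adjoin ⟨x, rfl⟩, rfl⟩, fun h => hx (Circle.ext h)⟩

theorem exists_bohrEmbedding_apply_ne_one {x : RealDiscrete} (hx : x ≠ 1) :
    ∃ t, bohrEmbedding t x ≠ 1 := by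
  have hx0 : x.toReal ≠ 0 := hx
  -- With this choice of `t` the value `e^{-itx}` equals `e^{iπ} = -1`.
  refine ⟨Multiplicative.ofAdd (-(Real.pi / x.toReal)), fun h => ?_⟩
  have h1 : Circle.exp (-(-(Real.pi / x.toReal) * x.toReal)) = 1 := h
  rw [neg_mul, neg_neg, div_mul_cancel₀ _ hx0] at h1
  have h2 := congrArg (fun z : Circle => (z : ℂ)) h1
  simp only [Circle.coe_exp, Complex.exp_pi_mul_I, Circle.coe_one] at h2
  norm_num at h2

theorem continuous_integral_continuousMap {X : Type*} [TopologicalSpace X] [CompactSpace X]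
    [MeasurableSpace X] [BorelSpace X] (μ : Measure X) [IsFiniteMeasure μ] :
    Continuous fun g : C(X, ℂ) => ∫ x, g x ∂μ := by
  have h := continuous_integral.comp (ContinuousMap.toLp (E := ℂ) 1 μ ℂ).continuous
  refine h.congr fun g => integral_congr_ae (ContinuousMap.coeFn_toLp μ g)

/-- Both sides are continuous and linear in `g`, so monomials suffice. A monomial with `x ≠ 1` is a
character that is nontrivial already on the image of the line, so both of its integrals vanish. -/
theorem integral_eq_integral_closureRange (g : C(BohrCompactification, ℂ)) :
    ∫ b, g b ∂(compactHaar BohrCompactification) =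
      ∫ b, g (b : BohrCompactification) ∂(compactHaar (closureRange bohrEmbedding)) := by
  let ι : C(closureRange bohrEmbedding, BohrCompactification) := ⟨_, continuous_subtype_val⟩
  have hint : ∀ f : C(BohrCompactification, ℂ), Integrable f (compactHaar _) := fun f =>
    f.continuous.integrable_of_hasCompactSupport (HasCompactSupport.of_compactSpace _)
  have hint' : ∀ f : C(closureRange bohrEmbedding, ℂ), Integrable f (compactHaar _) := fun f =>
    f.continuous.integrable_of_hasCompactSupport (HasCompactSupport.of_compactSpace _)
  have hcl : IsClosed {f : C(BohrCompactification, ℂ) |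
      ∫ b, f b ∂(compactHaar BohrCompactification) =
        ∫ b, (f.comp ι) b ∂(compactHaar (closureRange bohrEmbedding))} :=
    isClosed_eq (continuous_integral_continuousMap _)
      ((continuous_integral_continuousMap _).comp (ContinuousMap.continuous_precomp ι))
  have hg : g ∈ (Submodule.span ℂ (Set.range bohrMonomial)).topologicalClosure := by
    rw [dense_span_bohrMonomial]
    trivial
  refine closure_minimal (fun f hf => ?_) hcl hg
  rw [Set.mem_ofPred_eq]
  induction hf using Submodule.span_induction with
  | mem f hf =>
    obtain ⟨x, rfl⟩ := hf
    by_cases hx : x = 1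
    · simp [hx]
    · obtain ⟨t, ht⟩ := exists_bohrEmbedding_apply_ne_one hx
      have h1 : bohrEval x ≠ 1 := fun h => ht (DFunLike.congr_fun h (bohrEmbedding t))
      let χ : PontryaginDual (closureRange bohrEmbedding) :=
        PontryaginDual.map ⟨(closureRange bohrEmbedding).subtype, continuous_subtype_val⟩
          (bohrEval x)
      have h2 : χ ≠ 1 := fun h =>
        ht (DFunLike.congr_fun h (⟨bohrEmbedding t, mem_closureRange _ t⟩ : closureRange _))
      exact (integral_char_eq_zero h1).trans (integral_char_eq_zero h2).symm
  | zero => simp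
  | add f k _ _ hf hk =>
    have h1 := integral_add (hint f) (hint k)
    have h2 := integral_add (hint' (f.comp ι)) (hint' (k.comp ι))
    exact h1.trans ((congrArg₂ _ hf hk).trans h2.symm)
  | smul c f _ hf =>
    have h1 := integral_const_mul (μ := compactHaar BohrCompactification) c f
    have h2 := integral_const_mul (μ := compactHaar (closureRange bohrEmbedding)) c (f.comp ι)
    exact h1.trans ((congrArg _ hf).trans h2.symm)

/-- A Urysohn function that vanishes on the closure of the image and equals `1` at a point `b`
outside would have integral zero over the closure, but positive integral over the whole group,
because Haar measure charges open sets. -/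
theorem isDirichletGroup_bohrEmbedding : IsDirichletGroup bohrEmbedding := by
  intro b
  by_contra hb
  have hb' : b ∉ closureRange bohrEmbedding := hb
  obtain ⟨k, hk0, hk1, hk⟩ := exists_continuous_zero_one_of_isClosed
    (isClosed_closureRange bohrEmbedding) (isClosed_singleton (x := b))
    (Set.disjoint_singleton_right.2 hb')
  have h := integral_eq_integral_closureRange
    ⟨fun x => (k x : ℂ), Complex.continuous_ofReal.comp k.continuous⟩
  simp only [ContinuousMap.coe_mk] at h
  rw [integral_complex_ofReal, integral_complex_ofReal, Complex.ofReal_inj] at h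
  have h0 : ∀ c : closureRange bohrEmbedding, k c = 0 := fun c => hk0 c.2
  simp only [h0, integral_zero] at h
  have hpos : 0 < ∫ x, k x ∂(compactHaar BohrCompactification) := by
    refine k.continuous.integral_pos_of_hasCompactSupport_nonneg_nonzero
      (HasCompactSupport.of_compactSpace _) (fun x => (hk x).1) (x := b) ?_
    rw [hk1 rfl]
    exact one_ne_zero
  exact hpos.ne' h

/-- The Bohr compactification of the real line is a Dirichlet group for every frequency. -/
theorem isLambdaDirichletGroup_bohrEmbedding (lam : ℕ → ℝ) :
    IsLambdaDirichletGroup lam bohrEmbedding where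
  isDirichletGroup := isDirichletGroup_bohrEmbedding
  mem_range n := ⟨_, map_bohrEval (lam n)⟩

end Bohr

end

/-! ### The main theorem -/

theorem mainTheorem2 (lam : ℕ → ℝ) (hlam : IsFrequency lam) (p : ℝ≥0∞) [Fact (1 ≤ p)] :
    -- the Bohr compactification of the real line is a Dirichlet group for the given frequency
    IsLambdaDirichletGroup lam bohrEmbedding ∧
    -- comparison with the Bohr compactification
    (∀ (G : Type*) [CommGroup G] [TopologicalSpace G] [IsTopologicalGroup G] [CompactSpace G]
        [T2Space G] [MeasurableSpace G] [BorelSpace G] (β : Multiplicative ℝ →ₜ* G),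
      IsLambdaDirichletGroup lam β →
        ∃ Ψ : lambdaHardySpace p lam β ≃ₗᵢ[ℂ] lambdaHardySpace p lam bohrEmbedding,
          ∀ (f : lambdaHardySpace p lam β) (n : ℕ),
            haarFourierCoeff (f : Lp ℂ p (compactHaar G)) (extChar β (lam n)) =
              haarFourierCoeff (Ψ f : Lp ℂ p (compactHaar BohrCompactification))
                (extChar bohrEmbedding (lam n))) ∧
    -- the Bohr map is injective, so that the norm of a Dirichlet series is well defined
    (∀ (G : Type*) [CommGroup G] [TopologicalSpace G] [IsTopologicalGroup G] [CompactSpace G]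
        [T2Space G] [MeasurableSpace G] [BorelSpace G] (β : Multiplicative ℝ →ₜ* G),
      IsLambdaDirichletGroup lam β →
        Function.Injective (bohrMap p lam β) ∧
        ∀ f : lambdaHardySpace p lam β,
          dirichletHardyNorm p lam β (bohrMap p lam β f) = ‖f‖) ∧
    -- comparison of two groups, and independence of the group
    (∀ (G : Type*) [CommGroup G] [TopologicalSpace G] [IsTopologicalGroup G] [CompactSpace G]
        [T2Space G] [MeasurableSpace G] [BorelSpace G] (β : Multiplicative ℝ →ₜ* G)
        (H : Type*) [CommGroup H] [TopologicalSpace H] [IsTopologicalGroup H] [CompactSpace H]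
        [T2Space H] [MeasurableSpace H] [BorelSpace H] (β' : Multiplicative ℝ →ₜ* H),
      IsLambdaDirichletGroup lam β → IsLambdaDirichletGroup lam β' →
        (∃ Ψ : lambdaHardySpace p lam β ≃ₗᵢ[ℂ] lambdaHardySpace p lam β',
          ∀ (f : lambdaHardySpace p lam β) (n : ℕ),
            haarFourierCoeff (f : Lp ℂ p (compactHaar G)) (extChar β (lam n)) =
              haarFourierCoeff (Ψ f : Lp ℂ p (compactHaar H)) (extChar β' (lam n))) ∧
        dirichletHardySpace p lam β = dirichletHardySpace p lam β' ∧
        ∀ D ∈ dirichletHardySpace p lam β,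
          dirichletHardyNorm p lam β D = dirichletHardyNorm p lam β' D) := by
  refine ⟨isLambdaDirichletGroup_bohrEmbedding lam, ?_, ?_, ?_⟩
  · intro G _ _ _ _ _ _ _ β hβ
    exact exists_hardy_equiv p hβ (isLambdaDirichletGroup_bohrEmbedding lam)
  · intro G _ _ _ _ _ _ _ β _
    exact ⟨bohrMap_injective p, dirichletHardyNorm_bohrMap p⟩
  · intro G _ _ _ _ _ _ _ β H _ _ _ _ _ _ _ β' hβ hβ'
    obtain ⟨Ψ, hΨ⟩ := exists_hardy_equiv p hβ hβ'
    -- The isometry intertwines the two Bohr maps, so their ranges and the transported norms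
    -- coincide.
    have hmap : ∀ f, bohrMap p lam β f = bohrMap p lam β' (Ψ f) := fun f => funext (hΨ f)
    refine ⟨⟨Ψ, hΨ⟩, ?_, ?_⟩
    · refine le_antisymm ?_ ?_
      · rintro _ ⟨f, rfl⟩
        exact ⟨Ψ f, (hmap f).symm⟩
      · rintro _ ⟨f, rfl⟩
        exact ⟨Ψ.symm f, by rw [hmap, LinearIsometryEquiv.apply_symm_apply]⟩
    · rintro _ ⟨f, rfl⟩
      rw [dirichletHardyNorm_bohrMap p, hmap, dirichletHardyNorm_bohrMap p,
        LinearIsometryEquiv.norm_map]
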